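/- There exist a reflexive real Banach space $Y$ and a function $g:[0,1]\to Y$ which is scalarly null but not McShane integrable. Here $[0,1]$ carries its usual topology and Lebesgue measure $\mu$. Reflexive means that the canonical embedding $Y\to Y^{**}$ is onto. Scalarly null means that for every $y^*\in Y^*$ the composition $y^*\circ g$ vanishes $\mu$-almost everywhere (the exceptional set may depend on $y^*$). A function $g:[0,1]\to Y$ is McShane integrable if there is $y\in Y$ such that for every $\varepsilon>0$ there exist $\eta>0$ and open sets $\delta(t)\subseteq[0,1]$ with $t\in\delta(t)$ for all $t\in[0,1]$ such that, for every finite family $(E_i)$ of pairwise disjoint Lebesgue measurable subsets of $[0,1]$ with $\mu([0,1]\setminus\bigcup_i E_i)\le\eta$ and every choice of points $t_i\in[0,1]$ with $E_i\subseteq\delta(t_i)$, one has $\bigl\|\sum_i \mu(E_i)\,g(t_i)-y\bigr\|\le\varepsilon$. -/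

import Mathlib

open MeasureTheory

section McShane

variable {Ω X : Type*} [TopologicalSpace Ω] [MeasurableSpace Ω]
  [NormedAddCommGroup X] [NormedSpace ℝ X]

/-- A gauge on a topological space: to each point `t` it attaches an open set containing `t`. -/
def IsGauge (δ : Ω → Set Ω) : Prop :=
  ∀ t, IsOpen (δ t) ∧ t ∈ δ t

/-- `f` is McShane integrable with integral `x`.  The measurable sets are those of the completion
of `μ` (for Lebesgue measure, the Lebesgue measurable sets), that is, the `NullMeasurableSet`s.
The family `E` is `η`-thick: the complement of its union has measure at most `η`. -/
def HasMcShaneIntegral (μ : Measure Ω) (f : Ω → X) (x : X) : Prop :=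
  ∀ ε : ℝ, 0 < ε → ∃ η : ℝ, 0 < η ∧ ∃ δ : Ω → Set Ω, IsGauge δ ∧
    ∀ (n : ℕ) (E : Fin n → Set Ω) (t : Fin n → Ω),
      (∀ i, NullMeasurableSet (E i) μ) →
      (∀ i j, i ≠ j → Disjoint (E i) (E j)) →
      μ (⋃ i, E i)ᶜ ≤ ENNReal.ofReal η →
      (∀ i, E i ⊆ δ (t i)) →
      ‖(∑ i, μ.real (E i) • f (t i)) - x‖ ≤ ε

/-- `f` is McShane integrable. -/
def McShaneIntegrable (μ : Measure Ω) (f : Ω → X) : Prop :=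
  ∃ x : X, HasMcShaneIntegral μ f x

/-- `f` is scalarly null: every composition with a continuous functional vanishes almost
everywhere, the exceptional set depending on the functional. -/
def ScalarlyNull {Ω X : Type*} [MeasurableSpace Ω] [NormedAddCommGroup X] [NormedSpace ℝ X]
    (μ : Measure Ω) (f : Ω → X) : Prop :=
  ∀ φ : StrongDual ℝ X, ∀ᵐ t ∂μ, φ (f t) = 0

end McShane

/-- A real normed space is reflexive if the canonical embedding into its bidual is onto. -/
def IsReflexiveSpace (X : Type*) [NormedAddCommGroup X] [NormedSpace ℝ X] : Prop :=
  Function.Surjective (NormedSpace.inclusionInDoubleDual ℝ X)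

/-!
The space `Y` consists of functions on `Γ = [0,1]`, and `g t` is the unit vector `single t`.

*Admissible sets.* Let `d : Γ → Γ → ℕ`. A finite set is admissible if its cardinality is at most
`d x y` for any two distinct points `x, y` of it. No infinite set has all its finite subsets
admissible, and this makes the unit vectors weakly null for the norm `sup_A ∑_{x ∈ A} |a x|`, where
`A` runs over the admissible sets (`InterpSpace.exists_level_zero_lt_three`).

*The space.* Let `mass d k a` be the largest `ℓ¹` mass of `a` on a union of at most `k` admissible
sets. The norm of `InterpSpace d` is the `ℓ²` norm of the sequence `2⁻ⁿ mass d (4ⁿ) a`. This is an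
explicit form of an interpolation space, in the sense of Davis, Figiel, Johnson and Pełczyński,
between `ℓ¹(Γ)` and the norm above: for every `m`, a vector of the unit ball is the sum of one of
`ℓ¹` norm at most `2ᵐ` and one of size at most `2 · 2⁻ᵐ` in the weaker norm
(`InterpSpace.exists_level_zero_sub_restrict_le`). Moreover each functional is, up to a small
multiple of the norm, continuous for the weaker norm (`InterpSpace.exists_abs_le_level_zero`).
Together these show that the coordinate functionals span a dense subspace of the dual
(`InterpSpace.exists_abs_apply_le_of_vanish`). As a function belongs to the space as soon as its
finite restrictions are bounded, the space is reflexive (`InterpSpace.isReflexiveSpace`).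

*Scalarly null.* A functional is nonzero at countably many unit vectors only.

*Not McShane integrable.* Take uncountably many disjoint sets `S j ⊆ [0,1]` of outer measure at
least `α > 0` (`exists_pairwise_disjoint_volume_ge`), label them by distinct reals `s j`, and let
`d t t'` be the integer part of the inverse distance of the labels of `t` and `t'`. Given a gauge,
shrink it to members of a countable basis. Finitely many of the basic sets attached to the points of
`S j` have measure more than `β < α` together, and by uncountability the same finite family serves
infinitely many `j`, with labels as close as desired. Choosing the tags in different such `S j`
gives an admissible set of tags. Changing these tags to others moves the Riemann sum by at least
the measure of the family (`exists_admissible_tags`, `not_mcShaneIntegrable_single`).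
-/

open scoped ENNReal Topology

/-! ### Admissible sets and the extended norm -/

section SequenceSpace

variable {Γ : Type*}

/-- A finite set is admissible for `d` if its cardinality is at most the value of `d` at each pair
of distinct points of it. Two points bound the size of every admissible set containing them, so no
infinite set has all its finite subsets admissible. -/
def Admissible (d : Γ → Γ → ℕ) (A : Finset Γ) : Prop :=
  ∀ x ∈ A, ∀ y ∈ A, x ≠ y → A.card ≤ d x y

/-- `B` is contained in the union of at most `k` admissible sets. -/
def CoveredBy (d : Γ → Γ → ℕ) (k : ℕ) (B : Finset Γ) : Prop :=
  ∃ 𝒜 : Finset (Finset Γ), 𝒜.card ≤ k ∧ (∀ A ∈ 𝒜, Admissible d A) ∧ ∀ x ∈ B, ∃ A ∈ 𝒜, x ∈ A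

/-- The largest `ℓ¹` mass of `a` on a finite set covered by at most `k` admissible sets. -/
noncomputable def mass (d : Γ → Γ → ℕ) (k : ℕ) (a : Γ → ℝ) : ℝ≥0∞ :=
  ⨆ (B : Finset Γ) (_ : CoveredBy d k B), ∑ x ∈ B, ‖a x‖ₑ

variable {d : Γ → Γ → ℕ} {k : ℕ} {a b : Γ → ℝ}

lemma Admissible.mono {A B : Finset Γ} (hA : Admissible d A) (h : B ⊆ A) : Admissible d B :=
  fun x hx y hy hxy => (Finset.card_le_card h).trans (hA x (h hx) y (h hy) hxy)

lemma admissible_singleton (x : Γ) : Admissible d {x} := by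
  intro y hy z hz hyz
  simp_all

lemma Admissible.coveredBy {A : Finset Γ} (hA : Admissible d A) (hk : 1 ≤ k) :
    CoveredBy d k A :=
  ⟨{A}, by simpa using hk, by simpa using hA, by simp⟩

lemma sum_le_mass {B : Finset Γ} (hB : CoveredBy d k B) : ∑ x ∈ B, ‖a x‖ₑ ≤ mass d k a :=
  le_iSup₂ (f := fun (B : Finset Γ) (_ : CoveredBy d k B) => ∑ x ∈ B, ‖a x‖ₑ) B hB

lemma mass_add_le : mass d k (a + b) ≤ mass d k a + mass d k b := by
  refine iSup₂_le fun B hB => ?_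
  calc ∑ x ∈ B, ‖(a + b) x‖ₑ ≤ ∑ x ∈ B, (‖a x‖ₑ + ‖b x‖ₑ) :=
        Finset.sum_le_sum fun x _ => enorm_add_le _ _
    _ = ∑ x ∈ B, ‖a x‖ₑ + ∑ x ∈ B, ‖b x‖ₑ := Finset.sum_add_distrib
    _ ≤ _ := add_le_add (sum_le_mass hB) (sum_le_mass hB)

lemma mass_smul (c : ℝ) : mass d k (c • a) = ‖c‖ₑ * mass d k a := by
  simp only [mass, ENNReal.mul_iSup, Pi.smul_apply, enorm_smul, Finset.mul_sum]

lemma mass_mono (h : ∀ x, ‖a x‖ₑ ≤ ‖b x‖ₑ) : mass d k a ≤ mass d k b :=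
  iSup₂_mono fun _ _ => Finset.sum_le_sum fun x _ => h x

lemma enorm_le_mass (hk : 1 ≤ k) (x : Γ) : ‖a x‖ₑ ≤ mass d k a := by
  simpa using sum_le_mass (a := a) ((admissible_singleton (d := d) x).coveredBy hk)

lemma mass_one_le {C : ℝ≥0∞} (h : ∀ A, Admissible d A → ∑ x ∈ A, ‖a x‖ₑ ≤ C) :
    mass d 1 a ≤ C := by
  classical
  refine iSup₂_le ?_
  rintro B ⟨𝒜, hc, hA, hB⟩
  rcases Finset.card_le_one_iff_subset_singleton.1 hc with ⟨A, hsub⟩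
  have hBA : ∀ x ∈ B, x ∈ A ∧ A ∈ 𝒜 := fun x hx => by
    obtain ⟨A', hA', hx'⟩ := hB x hx
    have := Finset.mem_singleton.1 (hsub hA')
    subst this
    exact ⟨hx', hA'⟩
  rcases B.eq_empty_or_nonempty with rfl | ⟨x, hx⟩
  · simp
  · exact h B ((hA A (hBA x hx).2).mono fun y hy => (hBA y hy).1)

lemma sum_biUnion_le {Γ : Type*} [DecidableEq Γ] (𝒜 : Finset (Finset Γ)) (f : Γ → ℝ≥0∞) :
    ∑ x ∈ 𝒜.biUnion id, f x ≤ ∑ A ∈ 𝒜, ∑ x ∈ A, f x := by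
  classical
  induction 𝒜 using Finset.induction_on with
  | empty => simp
  | insert A 𝒜 hA ih =>
    rw [Finset.biUnion_insert, Finset.sum_insert hA, id]
    have := Finset.sum_union_inter (s₁ := A) (s₂ := 𝒜.biUnion id) (f := f)
    exact (le_self_add.trans this.le).trans (by gcongr)

lemma mass_le_mul : mass d k a ≤ k * mass d 1 a := by
  classical
  refine iSup₂_le ?_
  rintro B ⟨𝒜, hc, hA, hB⟩
  calc ∑ x ∈ B, ‖a x‖ₑ ≤ ∑ x ∈ 𝒜.biUnion id, ‖a x‖ₑ :=
        Finset.sum_le_sum_of_subset fun x hx => by simpa using hB x hx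
    _ ≤ ∑ A ∈ 𝒜, ∑ x ∈ A, ‖a x‖ₑ := sum_biUnion_le _ _
    _ ≤ ∑ A ∈ 𝒜, mass d 1 a :=
        Finset.sum_le_sum fun A h => sum_le_mass ((hA A h).coveredBy le_rfl)
    _ = 𝒜.card * mass d 1 a := by simp
    _ ≤ k * mass d 1 a := by gcongr

lemma lowerSemicontinuous_mass : LowerSemicontinuous (mass d k) := by
  refine lowerSemicontinuous_iSup fun B => lowerSemicontinuous_iSup fun _ => ?_
  refine Continuous.lowerSemicontinuous ?_
  fun_prop

/-- The extended norm `(∑ₙ (2⁻ⁿ mass_{4ⁿ})²)^(1/2)`. -/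
noncomputable def interpNorm (d : Γ → Γ → ℕ) (a : Γ → ℝ) : ℝ≥0∞ :=
  (∑' n : ℕ, ((2 : ℝ≥0∞)⁻¹ ^ n * mass d (4 ^ n) a) ^ (2 : ℝ)) ^ (1 / 2 : ℝ)

lemma interpNorm_add_le : interpNorm d (a + b) ≤ interpNorm d a + interpNorm d b := by
  have h := ENNReal.lintegral_Lp_add_le (μ := (Measure.count : Measure ℕ)) (p := 2)
    (f := fun n => (2 : ℝ≥0∞)⁻¹ ^ n * mass d (4 ^ n) a)
    (g := fun n => (2 : ℝ≥0∞)⁻¹ ^ n * mass d (4 ^ n) b)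
    (Measurable.of_discrete).aemeasurable (Measurable.of_discrete).aemeasurable (by norm_num)
  simp only [lintegral_count, Pi.add_apply] at h
  refine le_trans ?_ h
  unfold interpNorm
  gcongr with n
  rw [← mul_add]
  gcongr
  exact mass_add_le

lemma interpNorm_smul (c : ℝ) : interpNorm d (c • a) = ‖c‖ₑ * interpNorm d a := by
  unfold interpNorm
  simp only [mass_smul]
  have : ∀ n : ℕ, ((2 : ℝ≥0∞)⁻¹ ^ n * (‖c‖ₑ * mass d (4 ^ n) a)) ^ (2 : ℝ)
      = ‖c‖ₑ ^ (2 : ℝ) * ((2 : ℝ≥0∞)⁻¹ ^ n * mass d (4 ^ n) a) ^ (2 : ℝ) := fun n => by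
    rw [← ENNReal.mul_rpow_of_nonneg _ _ (by norm_num)]
    ring_nf
  simp only [this, ENNReal.tsum_mul_left]
  rw [ENNReal.mul_rpow_of_nonneg _ _ (by norm_num), ← ENNReal.rpow_mul]
  norm_num

lemma interpNorm_mono (h : ∀ x, ‖a x‖ₑ ≤ ‖b x‖ₑ) : interpNorm d a ≤ interpNorm d b := by
  unfold interpNorm
  gcongr
  exact mass_mono h

lemma mass_le_interpNorm (n : ℕ) :
    (2 : ℝ≥0∞)⁻¹ ^ n * mass d (4 ^ n) a ≤ interpNorm d a := by
  have h := ENNReal.le_tsum (f := fun n : ℕ => ((2 : ℝ≥0∞)⁻¹ ^ n * mass d (4 ^ n) a) ^ (2 : ℝ)) n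
  have h2 := ENNReal.rpow_le_rpow h (z := 1 / 2) (by norm_num)
  rw [← ENNReal.rpow_mul] at h2
  simpa [interpNorm] using h2

lemma enorm_le_interpNorm (x : Γ) : ‖a x‖ₑ ≤ interpNorm d a := by
  have := mass_le_interpNorm (d := d) (a := a) 0
  simp only [pow_zero, one_mul] at this
  exact (enorm_le_mass le_rfl x).trans this

lemma lowerSemicontinuous_interpNorm : LowerSemicontinuous (interpNorm d) := by
  unfold interpNorm
  have h1 : LowerSemicontinuous fun a : Γ → ℝ =>
      ∑' n : ℕ, ((2 : ℝ≥0∞)⁻¹ ^ n * mass d (4 ^ n) a) ^ (2 : ℝ) := by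
    refine lowerSemicontinuous_tsum fun n => ?_
    refine Continuous.comp_lowerSemicontinuous
      (g := fun t : ℝ≥0∞ => ((2 : ℝ≥0∞)⁻¹ ^ n * t) ^ (2 : ℝ)) ?_ lowerSemicontinuous_mass ?_
    · refine ENNReal.continuous_rpow_const.comp (ENNReal.continuous_const_mul ?_)
      exact ENNReal.pow_ne_top (by simp)
    · intro s t hst
      dsimp only
      gcongr
  refine Continuous.comp_lowerSemicontinuous (g := fun t : ℝ≥0∞ => t ^ (1 / 2 : ℝ))
    ENNReal.continuous_rpow_const h1 ?_
  intro s t hst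
  dsimp only
  gcongr

/-! ### The Banach space -/

/-- The functions with finite `interpNorm`, as a vector space. -/
noncomputable def interpSubmodule (d : Γ → Γ → ℕ) : Submodule ℝ (Γ → ℝ) where
  carrier := {a | interpNorm d a ≠ ∞}
  add_mem' ha hb := ne_top_of_le_ne_top (ENNReal.add_ne_top.2 ⟨ha, hb⟩) interpNorm_add_le
  zero_mem' := by
    have := interpNorm_smul (d := d) (a := 0) 0
    simp only [smul_zero, enorm_zero, zero_mul] at this
    simp [this]
  smul_mem' c a ha := by
    simp only [Set.mem_ofPred_eq, interpNorm_smul] at ha ⊢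
    exact ENNReal.mul_ne_top (by simp) ha

/-- The Banach space of all `a : Γ → ℝ` with finite `interpNorm`. It is a type synonym for
`interpSubmodule d`, so that it does not inherit the product topology. -/
def InterpSpace (d : Γ → Γ → ℕ) : Type _ := interpSubmodule d

namespace InterpSpace

noncomputable instance : AddCommGroup (InterpSpace d) :=
  inferInstanceAs (AddCommGroup (interpSubmodule d))

noncomputable instance : Module ℝ (InterpSpace d) :=
  inferInstanceAs (Module ℝ (interpSubmodule d))

instance : FunLike (InterpSpace d) Γ ℝ := ⟨fun a => a.1, Subtype.val_injective⟩

/-- The element of the space given by a function with finite extended norm. -/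
def mk (a : Γ → ℝ) (ha : interpNorm d a ≠ ∞) : InterpSpace d := ⟨a, ha⟩

@[simp] lemma mk_apply (a : Γ → ℝ) (ha : interpNorm d a ≠ ∞) (x : Γ) : mk a ha x = a x := rfl

noncomputable instance : Norm (InterpSpace d) := ⟨fun a => (interpNorm d a).toReal⟩

@[simp] lemma add_apply (a b : InterpSpace d) (x : Γ) : (a + b) x = a x + b x := rfl
@[simp] lemma sub_apply (a b : InterpSpace d) (x : Γ) : (a - b) x = a x - b x := rfl
@[simp] lemma neg_apply (a : InterpSpace d) (x : Γ) : (-a) x = -a x := rfl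
@[simp] lemma smul_apply (c : ℝ) (a : InterpSpace d) (x : Γ) : (c • a) x = c * a x := rfl
@[simp] lemma zero_apply (x : Γ) : (0 : InterpSpace d) x = 0 := rfl

@[simp] lemma sum_apply {ι : Type*} (s : Finset ι) (f : ι → InterpSpace d) (x : Γ) :
    (∑ i ∈ s, f i) x = ∑ i ∈ s, f i x := by
  classical
  induction s using Finset.induction_on with
  | empty => simp
  | insert i s hi ih => simp [Finset.sum_insert hi, ih]

@[ext] lemma ext {a b : InterpSpace d} (h : ∀ x, a x = b x) : a = b :=
  DFunLike.ext _ _ h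

lemma interpNorm_ne_top (a : InterpSpace d) : interpNorm d a ≠ ∞ := a.2

lemma norm_def (a : InterpSpace d) : ‖a‖ = (interpNorm d a).toReal := rfl

lemma ofReal_norm (a : InterpSpace d) : ENNReal.ofReal ‖a‖ = interpNorm d a :=
  ENNReal.ofReal_toReal a.interpNorm_ne_top

lemma abs_apply_le (a : InterpSpace d) (x : Γ) : |a x| ≤ ‖a‖ := by
  have := ENNReal.toReal_mono a.interpNorm_ne_top (enorm_le_interpNorm (d := d) (a := a) x)
  simpa [norm_def] using this

noncomputable instance : NormedAddCommGroup (InterpSpace d) :=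
  NormedAddCommGroup.ofCore (𝕜 := ℝ)
    { norm_nonneg := fun _ => ENNReal.toReal_nonneg
      norm_smul := fun c a => by
        change (interpNorm d (c • ⇑a)).toReal = _
        rw [interpNorm_smul, ENNReal.toReal_mul]
        simp [norm_def]
      norm_triangle := fun a b => by
        have ha := a.interpNorm_ne_top
        have hb := b.interpNorm_ne_top
        rw [norm_def, norm_def, norm_def, ← ENNReal.toReal_add ha hb]
        exact ENNReal.toReal_mono (ENNReal.add_ne_top.2 ⟨ha, hb⟩) interpNorm_add_le
      norm_eq_zero_iff := fun a => by
        constructor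
        · intro h
          ext x
          have := abs_apply_le a x
          rw [h] at this
          simpa using this
        · rintro rfl
          have := interpNorm_smul (d := d) (a := 0) 0
          simp only [smul_zero, enorm_zero, zero_mul] at this
          change (interpNorm d (0 : Γ → ℝ)).toReal = 0
          simp [this] }

noncomputable instance : NormedSpace ℝ (InterpSpace d) :=
  NormedSpace.ofCore (𝕜 := ℝ)
    { norm_nonneg := fun a => norm_nonneg a
      norm_smul := fun c a => by
        change (interpNorm d (c • ⇑a)).toReal = _
        rw [interpNorm_smul, ENNReal.toReal_mul]
        simp [norm_def]
      norm_triangle := fun a b => norm_add_le a b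
      norm_eq_zero_iff := fun a => norm_eq_zero }

lemma norm_le_of_abs_le {a b : InterpSpace d} (h : ∀ x, |a x| ≤ |b x|) : ‖a‖ ≤ ‖b‖ :=
  ENNReal.toReal_mono b.interpNorm_ne_top <| interpNorm_mono fun x => by
    rw [← _root_.ofReal_norm, ← _root_.ofReal_norm]
    exact ENNReal.ofReal_le_ofReal (h x)

/-- A pointwise limit of a bounded net has norm at most the bound. -/
lemma interpNorm_le_of_tendsto {ι : Type*} {l : Filter ι} [l.NeBot] {u : ι → Γ → ℝ}
    {C : ℝ≥0∞} (hu : Filter.Tendsto u l (𝓝 a)) (hC : ∀ᶠ i in l, interpNorm d (u i) ≤ C) :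
    interpNorm d a ≤ C :=
  (lowerSemicontinuous_interpNorm.isClosed_preimage C).mem_of_tendsto hu hC

instance : CompleteSpace (InterpSpace d) := by
  refine Metric.complete_of_cauchySeq_tendsto fun u hu => ?_
  have hpt : ∀ x, ∃ r : ℝ, Filter.Tendsto (fun n => u n x) Filter.atTop (𝓝 r) := fun x => by
    refine cauchySeq_tendsto_of_complete ?_
    rw [Metric.cauchySeq_iff] at hu ⊢
    intro ε hε
    obtain ⟨N, hN⟩ := hu ε hε
    refine ⟨N, fun m hm n hn => lt_of_le_of_lt ?_ (hN m hm n hn)⟩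
    rw [Real.dist_eq, dist_eq_norm]
    exact abs_apply_le (u m - u n) x
  choose a ha using hpt
  have key : ∀ ε : ℝ, 0 < ε → ∃ N, ∀ n ≥ N,
      interpNorm d (⇑(u n) - a) ≤ ENNReal.ofReal ε := by
    intro ε hε
    obtain ⟨N, hN⟩ := Metric.cauchySeq_iff.1 hu ε hε
    refine ⟨N, fun n hn => interpNorm_le_of_tendsto (l := Filter.atTop)
      (u := fun m => ⇑(u n) - ⇑(u m)) ?_ ?_⟩
    · rw [tendsto_pi_nhds]
      intro x
      exact tendsto_const_nhds.sub (ha x)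
    · filter_upwards [Filter.eventually_ge_atTop N] with m hm
      have h1 := (hN n hn m hm).le
      rw [dist_eq_norm] at h1
      have h2 := ofReal_norm (u n - u m)
      exact h2.symm.le.trans (ENNReal.ofReal_le_ofReal h1)
  have hmem : a ∈ interpSubmodule d := by
    obtain ⟨N, hN⟩ := key 1 one_pos
    have h1 : ⇑(u N) - a ∈ interpSubmodule d :=
      ne_top_of_le_ne_top ENNReal.ofReal_ne_top (hN N le_rfl)
    have h2 := (interpSubmodule d).sub_mem (u N).interpNorm_ne_top h1
    simpa using h2
  refine ⟨mk a hmem, Metric.tendsto_atTop.2 fun ε hε => ?_⟩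
  obtain ⟨N, hN⟩ := key (ε / 2) (half_pos hε)
  refine ⟨N, fun n hn => ?_⟩
  rw [dist_eq_norm]
  have h1 := hN n hn
  have h2 : ‖u n - mk a hmem‖ ≤ ε / 2 :=
    ENNReal.toReal_le_of_le_ofReal (half_pos hε).le h1
  linarith

/-- The `n`-th term `2⁻ⁿ mass_{4ⁿ}` of the sequence whose `ℓ²` norm is the norm of the space. -/
noncomputable def level (n : ℕ) (a : InterpSpace d) : ℝ :=
  ((2 : ℝ≥0∞)⁻¹ ^ n * mass d (4 ^ n) a).toReal

lemma level_nonneg (n : ℕ) (a : InterpSpace d) : 0 ≤ level n a := ENNReal.toReal_nonneg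

lemma level_ne_top (n : ℕ) (a : InterpSpace d) :
    (2 : ℝ≥0∞)⁻¹ ^ n * mass d (4 ^ n) a ≠ ∞ :=
  ne_top_of_le_ne_top a.interpNorm_ne_top (mass_le_interpNorm n)

lemma mass_ne_top (n : ℕ) (a : InterpSpace d) : mass d (4 ^ n) a ≠ ∞ := by
  intro h
  refine level_ne_top n a ?_
  rw [h, ENNReal.mul_top]
  exact (ENNReal.pow_pos (by simp) n).ne'

lemma level_eq (n : ℕ) (a : InterpSpace d) :
    level n a = 2⁻¹ ^ n * (mass d (4 ^ n) a).toReal := by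
  simp [level]

lemma level_le_norm (n : ℕ) (a : InterpSpace d) : level n a ≤ ‖a‖ :=
  ENNReal.toReal_mono a.interpNorm_ne_top (mass_le_interpNorm n)

lemma level_add_le (n : ℕ) (a b : InterpSpace d) : level n (a + b) ≤ level n a + level n b := by
  rw [level_eq, level_eq, level_eq, ← mul_add,
    ← ENNReal.toReal_add (mass_ne_top n a) (mass_ne_top n b)]
  gcongr
  · exact ENNReal.add_ne_top.2 ⟨mass_ne_top n a, mass_ne_top n b⟩
  · exact mass_add_le

lemma level_neg (n : ℕ) (a : InterpSpace d) : level n (-a) = level n a := by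
  rw [level_eq, level_eq]
  congr 2
  exact le_antisymm (mass_mono fun x => by simp) (mass_mono fun x => by simp)

lemma level_le_two_pow_mul (n : ℕ) (a : InterpSpace d) : level n a ≤ 2 ^ n * level 0 a := by
  have h0 : mass d 1 a ≠ ∞ := by simpa using mass_ne_top 0 a
  have h := ENNReal.toReal_mono (ENNReal.mul_ne_top (by simp) h0)
    (mass_le_mul (d := d) (k := 4 ^ n) (a := a))
  rw [ENNReal.toReal_mul] at h
  have h4 : (2 : ℝ)⁻¹ ^ n * 4 ^ n = 2 ^ n := by
    rw [← mul_pow]; norm_num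
  rw [level_eq, level_eq]
  calc (2 : ℝ)⁻¹ ^ n * (mass d (4 ^ n) a).toReal ≤ 2⁻¹ ^ n * (4 ^ n * (mass d 1 a).toReal) := by
        gcongr; simpa using h
    _ = 2 ^ n * (2⁻¹ ^ 0 * (mass d (4 ^ 0) a).toReal) := by
        rw [← mul_assoc, h4]; simp

lemma hasSum_level_sq (a : InterpSpace d) : HasSum (fun n => level n a ^ 2) (‖a‖ ^ 2) := by
  have h1 : interpNorm d a ^ (2 : ℝ)
      = ∑' n : ℕ, ((2 : ℝ≥0∞)⁻¹ ^ n * mass d (4 ^ n) a) ^ (2 : ℝ) := by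
    rw [interpNorm, ← ENNReal.rpow_mul]; norm_num
  have hfin : ∑' n : ℕ, ((2 : ℝ≥0∞)⁻¹ ^ n * mass d (4 ^ n) a) ^ (2 : ℝ) ≠ ∞ := by
    rw [← h1]
    exact ENNReal.rpow_ne_top_of_nonneg (by norm_num) a.interpNorm_ne_top
  have h2 := ENNReal.hasSum_toReal hfin
  rw [← ENNReal.tsum_toReal_eq (ENNReal.ne_top_of_tsum_ne_top hfin), ← h1] at h2
  simpa [level, norm_def, ← ENNReal.toReal_rpow] using h2

lemma sum_abs_le_level {n : ℕ} {B : Finset Γ} (hB : CoveredBy d (4 ^ n) B) (a : InterpSpace d) :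
    ∑ x ∈ B, |a x| ≤ 2 ^ n * level n a := by
  have h := ENNReal.toReal_mono (mass_ne_top n a) (sum_le_mass (a := a) hB)
  rw [ENNReal.toReal_sum (by simp)] at h
  rw [level_eq, ← mul_assoc, ← mul_pow]
  simpa using h

lemma level_zero_le {a : InterpSpace d} {C : ℝ}
    (h : ∀ A, Admissible d A → ∑ x ∈ A, |a x| ≤ C) : level 0 a ≤ C := by
  have hC : 0 ≤ C := by simpa using h ∅ (by simp [Admissible])
  have : mass d 1 a ≤ ENNReal.ofReal C := mass_one_le fun A hA => by
    have := ENNReal.ofReal_le_ofReal (h A hA)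
    rw [ENNReal.ofReal_sum_of_nonneg (fun _ _ => abs_nonneg _)] at this
    simpa [← _root_.ofReal_norm] using this
  rw [level_eq]
  simpa using ENNReal.toReal_le_of_le_ofReal hC this

/-! ### Unit vectors and restrictions -/

section Basis

open Classical in
/-- The unit vector at `x`. -/
noncomputable def single (x : Γ) : InterpSpace d := mk (Pi.single x 1) <| by
  have hm : ∀ k, mass d k (Pi.single x 1) ≤ 1 := fun k => by
    refine iSup₂_le fun B _ => ?_
    have : ∀ y, ‖(Pi.single x 1 : Γ → ℝ) y‖ₑ = if y = x then 1 else 0 := fun y => by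
      by_cases h : y = x <;> simp [h]
    simp only [this, Finset.sum_ite_eq']
    split_ifs <;> simp
  refine ENNReal.rpow_ne_top_of_nonneg (by norm_num) (ne_top_of_le_ne_top ?_
    (ENNReal.tsum_le_tsum (g := fun n : ℕ => (2 : ℝ≥0∞)⁻¹ ^ n) fun n => ?_))
  · rw [ENNReal.tsum_geometric]; simp
  · have h1 : (2 : ℝ≥0∞)⁻¹ ^ n * mass d (4 ^ n) (Pi.single x 1) ≤ 2⁻¹ ^ n := by
      simpa using mul_le_mul_right (hm (4 ^ n)) ((2 : ℝ≥0∞)⁻¹ ^ n)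
    refine (ENNReal.rpow_le_rpow h1 (by norm_num)).trans ?_
    rw [ENNReal.rpow_two, sq]
    exact mul_le_of_le_one_right' (pow_le_one' (by simp) n)

open Classical in
lemma single_apply (x y : Γ) : (single x : InterpSpace d) y = if y = x then 1 else 0 := by
  exact Pi.single_apply x (1 : ℝ) y

lemma norm_single_le (x : Γ) : ‖(single x : InterpSpace d)‖ ≤ 2 := by
  have hs := hasSum_level_sq (single x : InterpSpace d)
  have hl : ∀ n, level n (single x : InterpSpace d) ≤ 2⁻¹ ^ n := fun n => by
    classical
    rw [level_eq]
    refine mul_le_of_le_one_right (by positivity) ?_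
    refine ENNReal.toReal_le_of_le_ofReal zero_le_one ?_
    rw [ENNReal.ofReal_one]
    refine iSup₂_le fun B _ => ?_
    have : ∀ y, ‖(single x : InterpSpace d) y‖ₑ = if y = x then 1 else 0 := fun y => by
      rw [single_apply]; split_ifs <;> simp
    simp only [this, Finset.sum_ite_eq']
    split_ifs <;> simp
  have h2 : ‖(single x : InterpSpace d)‖ ^ 2 ≤ 2 := by
    have hg := hasSum_geometric_two
    refine hasSum_le (fun n => ?_) hs hg
    have h0 := level_nonneg n (single x : InterpSpace d)
    have h1 : (2 : ℝ)⁻¹ ^ n ≤ 1 := pow_le_one₀ (by norm_num) (by norm_num)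
    rw [one_div]
    nlinarith [hl n]
  nlinarith [norm_nonneg (single x : InterpSpace d)]

/-- The restriction of `a` to a finite set. -/
noncomputable def restrict (B : Finset Γ) (a : InterpSpace d) : InterpSpace d :=
  ∑ x ∈ B, a x • single x

open Classical in
lemma restrict_apply (B : Finset Γ) (a : InterpSpace d) (y : Γ) :
    restrict B a y = if y ∈ B then a y else 0 := by
  simp [restrict, single_apply]

lemma norm_restrict_le (B : Finset Γ) (a : InterpSpace d) : ‖restrict B a‖ ≤ ‖a‖ :=
  norm_le_of_abs_le fun x => by
    classical
    rw [restrict_apply]; split_ifs <;> simp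

lemma sub_restrict_apply_of_mem {B : Finset Γ} {y : Γ} (hy : y ∈ B) (a : InterpSpace d) :
    (a - restrict B a) y = 0 := by
  classical
  simp [restrict_apply, hy]

lemma sub_restrict_apply_of_notMem {B : Finset Γ} {y : Γ} (hy : y ∉ B) (a : InterpSpace d) :
    (a - restrict B a) y = a y := by
  classical
  simp [restrict_apply, hy]

lemma abs_sub_restrict_apply_le (B : Finset Γ) (a : InterpSpace d) (y : Γ) :
    |(a - restrict B a) y| ≤ |a y| := by
  by_cases hy : y ∈ B
  · simp [sub_restrict_apply_of_mem hy]
  · rw [sub_restrict_apply_of_notMem hy]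

lemma norm_sub_restrict_le (B : Finset Γ) (a : InterpSpace d) : ‖a - restrict B a‖ ≤ ‖a‖ :=
  norm_le_of_abs_le fun x => abs_sub_restrict_apply_le B a x

end Basis

/-! ### Functionals -/

/-- In the `ℓ²` sum over the levels, a vector that is small at the first levels is nearly
orthogonal to a fixed one. -/
lemma exists_norm_add_sq_le (v : InterpSpace d) :
    ∃ c : ℝ, 0 < c ∧ ∀ u : InterpSpace d, ‖u‖ ≤ 1 → level 0 u ≤ c →
      ‖v + u‖ ^ 2 ≤ ‖v‖ ^ 2 + 2 := by
  have hv := hasSum_level_sq v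
  obtain ⟨N, hN⟩ : ∃ N, ‖v‖ ^ 2 - ∑ n ∈ Finset.range N, level n v ^ 2 ≤ 1 / 16 := by
    have := hv.tendsto_sum_nat.eventually (lt_mem_nhds
      (show ‖v‖ ^ 2 - 1 / 16 < ‖v‖ ^ 2 by linarith))
    obtain ⟨N, hN⟩ := this.exists
    exact ⟨N, by linarith⟩
  set K := ∑ n ∈ Finset.range N, 2 * level n v * 2 ^ n with hK
  have hK0 : 0 ≤ K := Finset.sum_nonneg fun n _ => by
    have := level_nonneg n v
    positivity
  refine ⟨1 / (2 * (K + 1)), by positivity, fun u hu hc => ?_⟩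
  have hus := hasSum_level_sq u
  have hvus := hasSum_level_sq (v + u)
  have hKc : K * level 0 u ≤ 1 / 2 := by
    have h1 : K * level 0 u ≤ K * (1 / (2 * (K + 1))) := by gcongr
    have h2 : K * (1 / (2 * (K + 1))) ≤ 1 / 2 := by
      rw [mul_one_div, div_le_div_iff₀ (by positivity) (by norm_num)]
      linarith
    linarith
  -- a majorant with the cross term `2xy` for `n < N`, and `4x² + y² / 4` in its place afterwards
  have hA := hasSum_sum_of_ne_finset_zero (L := .unconditional ℕ)
      (f := fun n => if n ∈ Finset.range N then
        2 * level n v * level n u - 4 * level n v ^ 2 - 1 / 4 * level n u ^ 2 else 0)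
      (s := Finset.range N) (fun n hn => by rw [if_neg hn])
  have hM := ((hv.mul_left 5).add (hus.mul_left (5 / 4))).add hA
  have hle := hasSum_le (fun n => ?_) hvus hM
  · rw [Finset.sum_congr rfl (g := fun n =>
        2 * level n v * level n u - 4 * level n v ^ 2 - 1 / 4 * level n u ^ 2)
        (fun n hn => by rw [if_pos hn]), Finset.sum_sub_distrib, Finset.sum_sub_distrib,
        ← Finset.mul_sum, ← Finset.mul_sum] at hle
    have h1 : ∑ n ∈ Finset.range N, 2 * level n v * level n u ≤ K * level 0 u := by
      rw [hK, Finset.sum_mul]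
      refine Finset.sum_le_sum fun n _ => ?_
      rw [mul_assoc _ (2 ^ n)]
      exact mul_le_mul_of_nonneg_left (level_le_two_pow_mul n u)
        (by have := level_nonneg n v; positivity)
    have h2 : 0 ≤ ∑ n ∈ Finset.range N, level n u ^ 2 := Finset.sum_nonneg fun n _ => sq_nonneg _
    have h3 : ‖u‖ ^ 2 ≤ 1 := by nlinarith [norm_nonneg u]
    linarith
  · have h1 := level_add_le n v u
    have h2 : level n (v + u) ^ 2 ≤ (level n v + level n u) ^ 2 :=
      pow_le_pow_left₀ (level_nonneg _ _) h1 2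
    split_ifs
    · nlinarith
    · nlinarith [sq_nonneg (2 * level n v - 1 / 2 * level n u)]

/-- Up to a small multiple of the norm, a functional is continuous for the weaker norm `level 0`.
Otherwise there are unit vectors, as small as desired in that norm, on which `φ` stays above `ε`;
sums of `K` nearly orthogonal ones have norm `O(√K)`, while `φ` is at least `K ε` there. -/
lemma exists_abs_le_level_zero (φ : StrongDual ℝ (InterpSpace d)) {ε : ℝ} (hε : 0 < ε) :
    ∃ C : ℝ, 0 ≤ C ∧ ∀ u : InterpSpace d, ‖u‖ ≤ 1 → |φ u| ≤ C * level 0 u + ε := by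
  by_contra! hcon
  have hpos : ∀ C : ℝ, 0 ≤ C → ∃ u : InterpSpace d, ‖u‖ ≤ 1 ∧ C * level 0 u + ε < φ u := by
    intro C hC
    obtain ⟨u, hu, h⟩ := hcon C hC
    rcases le_total 0 (φ u) with h0 | h0
    · exact ⟨u, hu, by rwa [abs_of_nonneg h0] at h⟩
    · refine ⟨-u, by simpa using hu, ?_⟩
      rw [level_neg, map_neg]
      rwa [abs_of_nonpos h0] at h
  have key : ∀ K : ℕ, ∃ v : InterpSpace d, K * ε ≤ φ v ∧ ‖v‖ ^ 2 ≤ 2 * K := by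
    intro K
    induction K with
    | zero => exact ⟨0, by simp⟩
    | succ K ih =>
      obtain ⟨v, hv1, hv2⟩ := ih
      obtain ⟨c, hc, H⟩ := exists_norm_add_sq_le v
      obtain ⟨u, hu1, hu2⟩ := hpos (‖φ‖ / c) (by positivity)
      have hl : level 0 u ≤ c := by
        have h1 : φ u ≤ ‖φ‖ := by
          refine (le_abs_self _).trans ((φ.le_opNorm u).trans ?_)
          exact mul_le_of_le_one_right (norm_nonneg _) hu1
        by_contra! hlt
        have h2 : ‖φ‖ / c * c ≤ ‖φ‖ / c * level 0 u := by gcongr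
        rw [div_mul_cancel₀ _ hc.ne'] at h2
        linarith
      have h0 : 0 ≤ ‖φ‖ / c * level 0 u := mul_nonneg (by positivity) (level_nonneg 0 u)
      refine ⟨v + u, ?_, ?_⟩
      · rw [map_add]; push_cast; linarith
      · push_cast
        linarith [H u hu1 hl]
  obtain ⟨K, hK⟩ := exists_nat_gt (2 * ‖φ‖ ^ 2 / ε ^ 2)
  obtain ⟨v, hv1, hv2⟩ := key K
  have h1 : K * ε ≤ ‖φ‖ * ‖v‖ := hv1.trans ((le_abs_self _).trans (φ.le_opNorm v))
  have h2 : (K * ε) ^ 2 ≤ ‖φ‖ ^ 2 * (2 * K) := by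
    calc (K * ε) ^ 2 ≤ (‖φ‖ * ‖v‖) ^ 2 := pow_le_pow_left₀ (by positivity) h1 2
      _ = ‖φ‖ ^ 2 * ‖v‖ ^ 2 := by ring
      _ ≤ _ := by gcongr
  have hK0 : (0 : ℝ) < K := lt_of_le_of_lt (by positivity) hK
  rw [div_lt_iff₀ (by positivity)] at hK
  nlinarith

/-- From the unit vectors of an infinite set one can form `K` disjoint averages whose sum `v` is
less than `3` at level `0`, uniformly in `K`: an admissible set with two points in the support of
the first averages has bounded size, and therefore little mass on an average over many points. -/
lemma exists_level_zero_lt_three (φ : StrongDual ℝ (InterpSpace d)) {δ : ℝ} {I : Set Γ}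
    (hI : I.Infinite) (hφ : ∀ x ∈ I, δ ≤ φ (single x)) (K : ℕ) :
    ∃ v : InterpSpace d, level 0 v < 3 ∧ ‖v‖ ≤ 2 * K ∧ K * δ ≤ φ v := by
  classical
  suffices H : ∃ (v : InterpSpace d) (S : Finset Γ), (∀ x ∉ S, v x = 0) ∧ (∀ x, |v x| ≤ 1) ∧
      level 0 v < 3 ∧ ‖v‖ ≤ 2 * K ∧ K * δ ≤ φ v by
    obtain ⟨v, S, -, -, h⟩ := H
    exact ⟨v, h⟩
  induction K with
  | zero =>
    exact ⟨0, ∅, by simp, by simp, by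
      refine lt_of_le_of_lt (level_zero_le (C := 0) fun A _ => by simp) (by norm_num), by simp,
      by simp⟩
  | succ K ih =>
    obtain ⟨v, S, hvS, hv1, hv3, hvK, hvφ⟩ := ih
    -- an admissible set with two points in `S` has at most `D` elements
    set D : ℕ := ∑ p ∈ S ×ˢ S, d p.1 p.2
    have hDle : ∀ x ∈ S, ∀ y ∈ S, d x y ≤ D := fun x hx y hy =>
      Finset.single_le_sum (f := fun p : Γ × Γ => d p.1 p.2) (fun _ _ => Nat.zero_le _)
        (Finset.mk_mem_product hx hy)
    obtain ⟨N, hN⟩ := exists_nat_gt (D / (3 - level 0 v))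
    have h3 : 0 < 3 - level 0 v := by linarith
    have hN0 : (0 : ℝ) < N := lt_of_le_of_lt (by positivity) hN
    have hDN : level 0 v + D * (N : ℝ)⁻¹ < 3 := by
      rw [div_lt_iff₀ h3] at hN
      have : D * (N : ℝ)⁻¹ < 3 - level 0 v := by
        rw [← div_eq_mul_inv, div_lt_iff₀ hN0]; linarith
      linarith
    obtain ⟨T, hTsub, hTcard⟩ := (hI.sdiff S.finite_toSet).exists_subset_card_eq N
    have hTI : ∀ x ∈ T, x ∈ I := fun x hx => (hTsub hx).1
    have hTS : ∀ x ∈ T, x ∉ S := fun x hx h => (hTsub hx).2 h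
    set b : InterpSpace d := (N : ℝ)⁻¹ • ∑ x ∈ T, single x with hb
    have hbapp : ∀ y, b y = if y ∈ T then (N : ℝ)⁻¹ else 0 := fun y => by
      simp [hb, single_apply]
    have hNinv : (N : ℝ)⁻¹ ≤ 1 := inv_le_one_of_one_le₀ (by
      have : 0 < N := by exact_mod_cast hN0
      exact_mod_cast this)
    have hbsum : ∀ A : Finset Γ, ∑ x ∈ A, |b x| = (A ∩ T).card * (N : ℝ)⁻¹ := fun A => by
      have : ∀ y, |b y| = if y ∈ T then (N : ℝ)⁻¹ else 0 := fun y => by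
        rw [hbapp]; split_ifs <;> simp
      simp only [this, ← Finset.sum_filter, Finset.filter_mem_eq_inter, Finset.sum_const,
        nsmul_eq_mul]
    refine ⟨v + b, S ∪ T, fun x hx => ?_, fun x => ?_, ?_, ?_, ?_⟩
    · rw [Finset.mem_union, not_or] at hx
      simp [hvS x hx.1, hbapp, hx.2]
    · rw [add_apply, hbapp]
      split_ifs with h
      · rw [hvS x (hTS x h), zero_add, abs_of_pos (by positivity)]
        exact hNinv
      · simpa using hv1 x
    · refine lt_of_le_of_lt (level_zero_le (C := max 2 (level 0 v + D * (N : ℝ)⁻¹))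
        fun A hA => ?_) (max_lt (by norm_num) hDN)
      have htri : ∑ x ∈ A, |(v + b) x| ≤ ∑ x ∈ A, |v x| + ∑ x ∈ A, |b x| := by
        rw [← Finset.sum_add_distrib]
        exact Finset.sum_le_sum fun x _ => abs_add_le _ _
      refine htri.trans ?_
      by_cases hcard : (A ∩ S).card ≤ 1
      · refine le_max_of_le_left ?_
        have h1 : ∑ x ∈ A, |v x| ≤ 1 := by
          calc ∑ x ∈ A, |v x| = ∑ x ∈ A ∩ S, |v x| := by
                refine (Finset.sum_subset Finset.inter_subset_left fun x hx hx' => ?_).symm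
                have : x ∉ S := fun h => hx' (Finset.mem_inter.2 ⟨hx, h⟩)
                simp [hvS x this]
            _ ≤ ∑ x ∈ A ∩ S, (1 : ℝ) := Finset.sum_le_sum fun x _ => hv1 x
            _ ≤ 1 := by simpa using hcard
        have h2 : ∑ x ∈ A, |b x| ≤ 1 := by
          rw [hbsum, ← div_eq_mul_inv, div_le_one hN0, ← hTcard]
          exact_mod_cast Finset.card_le_card Finset.inter_subset_right
        linarith
      · refine le_max_of_le_right ?_
        obtain ⟨x, hx, y, hy, hxy⟩ := Finset.one_lt_card.1 (not_le.1 hcard)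
        rw [Finset.mem_inter] at hx hy
        have hAD : A.card ≤ D := (hA x hx.1 y hy.1 hxy).trans (hDle x hx.2 y hy.2)
        have h1 : ∑ x ∈ A, |v x| ≤ level 0 v := by
          simpa using sum_abs_le_level (n := 0) (hA.coveredBy le_rfl) v
        have h2 : ∑ x ∈ A, |b x| ≤ D * (N : ℝ)⁻¹ := by
          rw [hbsum]
          gcongr
          exact (Finset.card_le_card Finset.inter_subset_left).trans hAD
        linarith
    · have hbn : ‖b‖ ≤ 2 := by
        rw [hb, norm_smul, Real.norm_of_nonneg (by positivity)]
        calc (N : ℝ)⁻¹ * ‖∑ x ∈ T, (single x : InterpSpace d)‖ ≤ (N : ℝ)⁻¹ * ∑ x ∈ T, 2 := by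
              gcongr
              exact norm_sum_le_of_le _ fun x _ => norm_single_le x
          _ = 2 := by
              rw [Finset.sum_const, hTcard, nsmul_eq_mul, ← mul_assoc,
                inv_mul_cancel₀ hN0.ne', one_mul]
      push_cast
      linarith [norm_add_le v b]
    · have hbφ : δ ≤ φ b := by
        rw [hb, map_smul, map_sum, smul_eq_mul]
        calc δ = (N : ℝ)⁻¹ * ∑ x ∈ T, δ := by
              rw [Finset.sum_const, hTcard, nsmul_eq_mul, ← mul_assoc,
                inv_mul_cancel₀ hN0.ne', one_mul]
          _ ≤ _ := by
              gcongr with x hx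
              exact hφ x (hTI x hx)
      rw [map_add]
      push_cast
      linarith

lemma finite_le_apply_single (φ : StrongDual ℝ (InterpSpace d)) {δ : ℝ} (hδ : 0 < δ) :
    {x | δ ≤ φ (single x)}.Finite := by
  by_contra hinf
  obtain ⟨C, hC, H⟩ := exists_abs_le_level_zero φ (ε := δ / 4) (by positivity)
  obtain ⟨K, hK⟩ := exists_nat_gt (6 * C / δ)
  have hK0 : (0 : ℝ) < K := lt_of_le_of_lt (by positivity) hK
  obtain ⟨v, hv3, hvK, hvφ⟩ := exists_level_zero_lt_three φ hinf (fun x hx => hx) K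
  set c : ℝ := (2 * K)⁻¹ with hc
  have hc0 : 0 < c := by positivity
  have hlev : level 0 (c • v) ≤ c * 3 := by
    refine level_zero_le fun A hA => ?_
    simp only [smul_apply, abs_mul, ← Finset.mul_sum, abs_of_pos hc0]
    gcongr
    refine le_trans ?_ hv3.le
    simpa using sum_abs_le_level (n := 0) (hA.coveredBy le_rfl) v
  have hnorm : ‖c • v‖ ≤ 1 := by
    rw [norm_smul, Real.norm_of_nonneg hc0.le, hc, inv_mul_le_iff₀ (by positivity)]
    linarith
  have h1 := (le_abs_self _).trans (H (c • v) hnorm)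
  rw [map_smul, smul_eq_mul] at h1
  have h2 : c * (K * δ) ≤ C * (c * 3) + δ / 4 := by
    calc c * (K * δ) ≤ c * φ v := by gcongr
      _ ≤ C * level 0 (c • v) + δ / 4 := h1
      _ ≤ _ := by gcongr
  rw [div_lt_iff₀ hδ] at hK
  have hcK : c * K = 1 / 2 := by rw [hc]; field_simp
  nlinarith

/-- The unit vectors tend weakly to zero along the cofinite filter. -/
lemma finite_le_abs_apply_single (φ : StrongDual ℝ (InterpSpace d)) {δ : ℝ} (hδ : 0 < δ) :
    {x | δ ≤ |φ (single x)|}.Finite := by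
  refine ((finite_le_apply_single φ hδ).union (finite_le_apply_single (-φ) hδ)).subset ?_
  intro x hx
  rcases le_abs'.1 (show δ ≤ |φ (single x)| from hx) with h | h
  · right
    change δ ≤ -(φ (single x))
    linarith
  · exact Or.inl h

lemma countable_apply_single_ne_zero (φ : StrongDual ℝ (InterpSpace d)) :
    {x | φ (single x) ≠ 0}.Countable := by
  refine (Set.countable_iUnion fun n : ℕ =>
    (finite_le_abs_apply_single φ (δ := 1 / ((n : ℝ) + 1)) (by positivity)).countable).mono ?_
  intro x hx
  obtain ⟨n, hn⟩ := exists_nat_one_div_lt (abs_pos.2 hx)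
  exact Set.mem_iUnion.2 ⟨n, hn.le⟩

/-- Greedy removal of admissible sets of mass more than `2 · 2⁻ᵐ`: since level `m` sees the union of
`4ᵐ` of them, the process stops before that. Thus each vector of the unit ball is the sum of
one of `ℓ¹` norm at most `2ᵐ` and one that is small at level `0`. -/
lemma exists_level_zero_sub_restrict_le {a : InterpSpace d} (ha : ‖a‖ ≤ 1) (m : ℕ) :
    ∃ B : Finset Γ, ∑ x ∈ B, |a x| ≤ 2 ^ m ∧ level 0 (a - restrict B a) ≤ 2 * 2⁻¹ ^ m := by
  classical
  set δ : ℝ := 2 * 2⁻¹ ^ m with hδ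
  have hδ0 : 0 < δ := by positivity
  have hmass : ∀ B, CoveredBy d (4 ^ m) B → ∑ x ∈ B, |a x| ≤ 2 ^ m := fun B hB => by
    refine (sum_abs_le_level hB a).trans ?_
    exact mul_le_of_le_one_right (by positivity) ((level_le_norm m a).trans ha)
  have key : ∀ r : ℕ, ∃ 𝒜 : Finset (Finset Γ), 𝒜.card ≤ r ∧ (∀ A ∈ 𝒜, Admissible d A) ∧
      (level 0 (a - restrict (𝒜.biUnion id) a) ≤ δ ∨ r * δ ≤ ∑ x ∈ 𝒜.biUnion id, |a x|) := by
    intro r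
    induction r with
    | zero => exact ⟨∅, by simp⟩
    | succ r ih =>
      obtain ⟨𝒜, hc, hA, h⟩ := ih
      by_cases hgood : level 0 (a - restrict (𝒜.biUnion id) a) ≤ δ
      · exact ⟨𝒜, by omega, hA, Or.inl hgood⟩
      replace h := h.resolve_left hgood
      obtain ⟨A, hAadm, hAδ⟩ : ∃ A, Admissible d A ∧
          δ < ∑ x ∈ A, |(a - restrict (𝒜.biUnion id) a) x| := by
        by_contra! hcon
        exact hgood (level_zero_le hcon)
      refine ⟨insert A 𝒜, (Finset.card_insert_le _ _).trans (by omega), fun A' hA' => ?_,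
        Or.inr ?_⟩
      · rcases Finset.mem_insert.1 hA' with rfl | h'
        · exact hAadm
        · exact hA A' h'
      · have h1 : ∑ x ∈ A, |(a - restrict (𝒜.biUnion id) a) x|
            = ∑ x ∈ A \ 𝒜.biUnion id, |a x| := by
          rw [← Finset.sum_subset (Finset.sdiff_subset (s := A) (t := 𝒜.biUnion id))]
          · refine Finset.sum_congr rfl fun x hx => ?_
            rw [sub_restrict_apply_of_notMem (Finset.mem_sdiff.1 hx).2]
          · intro x hx hx'
            rw [sub_restrict_apply_of_mem, abs_zero]
            by_contra h'
            exact hx' (Finset.mem_sdiff.2 ⟨hx, h'⟩)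
        rw [Finset.biUnion_insert, id, ← Finset.sdiff_union_self_eq_union,
          Finset.sum_union Finset.sdiff_disjoint, ← h1]
        push_cast
        linarith
  obtain ⟨𝒜, hc, hA, h⟩ := key (4 ^ m)
  have hB := hmass (𝒜.biUnion id) ⟨𝒜, hc, hA, fun x hx => by simpa using hx⟩
  refine ⟨𝒜.biUnion id, hB, h.resolve_right fun hcon => ?_⟩
  have h4 : ((4 ^ m : ℕ) : ℝ) * δ = 2 * 2 ^ m := by
    rw [hδ, mul_left_comm]
    push_cast
    rw [← mul_pow]; norm_num
  have : (0 : ℝ) < 2 ^ m := by positivity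
  linarith

/-- The unit vectors form a shrinking system: functionals are small on vectors that vanish on a
large finite set. -/
lemma exists_abs_apply_le_of_vanish (φ : StrongDual ℝ (InterpSpace d)) {ε : ℝ} (hε : 0 < ε) :
    ∃ S : Finset Γ, ∀ u : InterpSpace d, ‖u‖ ≤ 1 → (∀ x ∈ S, u x = 0) → |φ u| ≤ ε := by
  obtain ⟨C, hC, H⟩ := exists_abs_le_level_zero φ (ε := ε / 3) (by positivity)
  obtain ⟨m, hm⟩ : ∃ m : ℕ, C * (2 * 2⁻¹ ^ m) ≤ ε / 3 := by
    obtain ⟨m, hm⟩ := exists_pow_lt_of_lt_one (show 0 < ε / (6 * (C + 1)) by positivity)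
      (show (2⁻¹ : ℝ) < 1 by norm_num)
    refine ⟨m, ?_⟩
    rw [lt_div_iff₀ (by positivity)] at hm
    have : (0 : ℝ) < 2⁻¹ ^ m := by positivity
    nlinarith
  have hfin := finite_le_abs_apply_single φ (δ := ε / 3 * 2⁻¹ ^ m) (by positivity)
  refine ⟨hfin.toFinset, fun u hu hS => ?_⟩
  obtain ⟨B, hB1, hB2⟩ := exists_level_zero_sub_restrict_le hu m
  have h1 : |φ (u - restrict B u)| ≤ ε / 3 + ε / 3 := by
    refine (H _ ((norm_sub_restrict_le B u).trans hu)).trans ?_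
    gcongr
    exact le_trans (by gcongr) hm
  have h2 : |φ (restrict B u)| ≤ ε / 3 := by
    rw [restrict, map_sum]
    calc |∑ x ∈ B, φ (u x • single x)| ≤ ∑ x ∈ B, |φ (u x • single x)| :=
          Finset.abs_sum_le_sum_abs _ _
      _ ≤ ∑ x ∈ B, |u x| * (ε / 3 * 2⁻¹ ^ m) := by
          refine Finset.sum_le_sum fun x _ => ?_
          rw [map_smul, smul_eq_mul, abs_mul]
          by_cases hx : x ∈ hfin.toFinset
          · simp [hS x hx]
          · gcongr
            simp only [Set.Finite.mem_toFinset, Set.mem_ofPred_eq, not_le] at hx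
            exact hx.le
      _ ≤ 2 ^ m * (ε / 3 * 2⁻¹ ^ m) := by
          rw [← Finset.sum_mul]; gcongr
      _ = ε / 3 := by
          rw [mul_left_comm, ← mul_pow]; norm_num
  have h3 : φ u = φ (u - restrict B u) + φ (restrict B u) := by rw [← map_add]; simp
  rw [h3]
  linarith [abs_add_le (φ (u - restrict B u)) (φ (restrict B u))]

/-! ### Reflexivity -/

/-- Evaluation at `x`, as a continuous functional. -/
noncomputable def coord (x : Γ) : StrongDual ℝ (InterpSpace d) :=
  LinearMap.mkContinuous
    { toFun := fun a => a x
      map_add' := fun _ _ => rfl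
      map_smul' := fun _ _ => rfl } 1 fun a => by
        rw [one_mul]; exact abs_apply_le a x

@[simp] lemma coord_apply (x : Γ) (a : InterpSpace d) : coord x a = a x := rfl

/-- The functional `φ ∘ restrict S`, written through the coordinates. -/
noncomputable def restrictDual (S : Finset Γ) (φ : StrongDual ℝ (InterpSpace d)) :
    StrongDual ℝ (InterpSpace d) :=
  ∑ x ∈ S, φ (single x) • coord x

lemma restrictDual_apply (S : Finset Γ) (φ : StrongDual ℝ (InterpSpace d)) (a : InterpSpace d) :
    restrictDual S φ a = φ (restrict S a) := by
  simp [restrictDual, restrict, mul_comm]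

lemma norm_restrictDual_le (S : Finset Γ) (φ : StrongDual ℝ (InterpSpace d)) :
    ‖restrictDual S φ‖ ≤ ‖φ‖ :=
  ContinuousLinearMap.opNorm_le_bound _ (norm_nonneg _) fun a => by
    rw [restrictDual_apply]
    exact (φ.le_opNorm _).trans (by gcongr; exact norm_restrict_le S a)

lemma norm_sub_restrictDual_le {S : Finset Γ} {φ : StrongDual ℝ (InterpSpace d)} {ε : ℝ}
    (hε : 0 ≤ ε) (hS : ∀ u : InterpSpace d, ‖u‖ ≤ 1 → (∀ x ∈ S, u x = 0) → |φ u| ≤ ε) :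
    ‖φ - restrictDual S φ‖ ≤ ε := by
  refine ContinuousLinearMap.opNorm_le_of_unit_norm hε fun a ha => ?_
  rw [_root_.sub_apply, restrictDual_apply, ← map_sub, Real.norm_eq_abs]
  exact hS _ ((norm_sub_restrict_le S a).trans ha.le) fun x hx => sub_restrict_apply_of_mem hx a

/-- The space is reflexive. An element `ξ` of the bidual has coordinates `a x = ξ (coord x)`. The
finite restrictions of `a` have norm at most `‖ξ‖`, hence `a` is in the space; and `ξ` agrees
with `a` on the coordinate functionals, whose span is dense in the dual. -/
theorem isReflexiveSpace : IsReflexiveSpace (InterpSpace d) := by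
  classical
  intro ξ
  set a : Γ → ℝ := fun x => ξ (coord x) with ha
  have hξ : ∀ S φ, ξ (restrictDual S φ) = ∑ x ∈ S, φ (single x) * a x := fun S φ => by
    simp [restrictDual, ha]
  have hfin : ∀ S : Finset Γ, ‖∑ x ∈ S, a x • (single x : InterpSpace d)‖ ≤ ‖ξ‖ := fun S => by
    obtain ⟨φ, hφ1, hφ⟩ := exists_dual_vector'' ℝ (∑ x ∈ S, a x • (single x : InterpSpace d))
    have h1 : ξ (restrictDual S φ) = ‖∑ x ∈ S, a x • (single x : InterpSpace d)‖ := by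
      rw [hξ]
      simp only [RCLike.ofReal_real_eq_id, id] at hφ
      rw [← hφ, map_sum]
      simp [mul_comm]
    rw [← h1]
    calc ξ (restrictDual S φ) ≤ ‖ξ‖ * ‖restrictDual S φ‖ :=
          (le_abs_self _).trans (ξ.le_opNorm _)
      _ ≤ ‖ξ‖ * 1 := by
          gcongr
          exact (norm_restrictDual_le S φ).trans hφ1
      _ = ‖ξ‖ := mul_one _
  have hbdd : interpNorm d a ≤ ENNReal.ofReal ‖ξ‖ := by
    refine interpNorm_le_of_tendsto (l := Filter.atTop)
      (u := fun S : Finset Γ => ⇑(∑ x ∈ S, a x • (single x : InterpSpace d))) ?_ ?_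
    · rw [tendsto_pi_nhds]
      intro y
      refine tendsto_const_nhds.congr' ?_
      filter_upwards [Filter.eventually_ge_atTop {y}] with S hS
      have hy : y ∈ S := hS (Finset.mem_singleton_self y)
      simp [single_apply, hy]
    · refine Filter.Eventually.of_forall fun S => ?_
      rw [← ofReal_norm]
      exact ENNReal.ofReal_le_ofReal (hfin S)
  set A : InterpSpace d := mk a (ne_top_of_le_ne_top ENNReal.ofReal_ne_top hbdd) with hA
  refine ⟨A, ?_⟩
  ext φ
  rw [NormedSpace.dual_def]
  refine eq_of_forall_dist_le fun ε hε => ?_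
  set ε' := ε / (‖ξ‖ + ‖A‖ + 1) with hε'
  have hε'0 : 0 < ε' := by positivity
  obtain ⟨S, hS⟩ := exists_abs_apply_le_of_vanish φ hε'0
  have h1 := norm_sub_restrictDual_le hε'0.le hS
  have h2 : restrictDual S φ A = ξ (restrictDual S φ) := by
    rw [hξ, restrictDual_apply, restrict, map_sum]
    simp [hA, mul_comm]
  have h3 : φ A - ξ φ = (φ - restrictDual S φ) A - ξ (φ - restrictDual S φ) := by
    rw [map_sub, _root_.sub_apply, h2]; ring
  have hεeq : ε' * (‖ξ‖ + ‖A‖ + 1) = ε := div_mul_cancel₀ _ (by positivity)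
  rw [Real.dist_eq, h3]
  calc |(φ - restrictDual S φ) A - ξ (φ - restrictDual S φ)|
      ≤ ‖(φ - restrictDual S φ) A‖ + ‖ξ (φ - restrictDual S φ)‖ := abs_sub _ _
    _ ≤ ε' * ‖A‖ + ‖ξ‖ * ε' := by
        gcongr
        · exact ContinuousLinearMap.le_of_opNorm_le _ h1 A
        · exact ContinuousLinearMap.le_opNorm_of_le _ h1
    _ ≤ ε := by nlinarith

end InterpSpace

end SequenceSpace

/-! ### Disjoint non-null sets and close tags -/

section Partition

/-- Uncountably many pairwise disjoint subsets of `[0,1]`, of outer measure bounded below. Split a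
Hamel basis into uncountable pieces `0, 1, 2, …`; the reals with no component along the pieces
from `n` on form a set which is not null for some `n`, and its translates by rational multiples of
the basis vectors in piece `n` are disjoint. -/
theorem exists_pairwise_disjoint_volume_ge :
    ∃ (J : Type) (S : J → Set unitInterval) (s : J → ℝ) (α : ℝ≥0∞), Uncountable J ∧ 0 < α ∧
      Function.Injective s ∧ (∀ i j, i ≠ j → Disjoint (S i) (S j)) ∧ ∀ j, α ≤ volume (S j) := by
  classical
  set B := Module.Basis.ofVectorSpace ℚ ℝ with hB
  set ι := Module.Basis.ofVectorSpaceIndex ℚ ℝ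
  have hι : Uncountable ι := by
    by_contra h
    rw [not_uncountable_iff] at h
    have : Countable ℝ := B.repr.toEquiv.injective.countable
    exact Cardinal.not_countable_real (Set.countable_univ_iff.2 this)
  obtain ⟨e⟩ : Nonempty (ι ≃ ι × ℕ) := by
    rw [← Cardinal.eq]
    simp [Cardinal.mul_aleph0_eq (Cardinal.aleph0_le_mk ι)]
  set V : ℕ → Set ℝ := fun n => {x | ∀ i, B.repr x i ≠ 0 → (e i).2 < n} with hV
  have hVcover : (⋃ n, V n) = Set.univ := by
    refine Set.eq_univ_of_forall fun x => Set.mem_iUnion.2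
      ⟨(B.repr x).support.sup (fun i => (e i).2) + 1, fun i hi => ?_⟩
    exact Nat.lt_succ_of_le (Finset.le_sup (f := fun i => (e i).2) (Finsupp.mem_support_iff.2 hi))
  obtain ⟨n, hn⟩ : ∃ n, volume (V n) ≠ 0 := by
    by_contra! h
    have := measure_iUnion_null h
    rw [hVcover] at this
    simp at this
  obtain ⟨k, hk⟩ : ∃ k : ℤ, volume (V n ∩ Set.Ico ((k : ℝ) / 2) ((k + 1) / 2)) ≠ 0 := by
    by_contra! h
    refine hn (measure_mono_null (fun x hx => ?_) (measure_iUnion_null h))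
    refine Set.mem_iUnion.2 ⟨⌊2 * x⌋, hx, ?_, ?_⟩
    · have := Int.floor_le (2 * x); linarith
    · have := Int.lt_floor_add_one (2 * x); linarith
  -- a window of length `1 / 2`, to be shifted to `[0, 1 / 2)` and then translated by `s j < 1 / 2`
  set W := V n ∩ Set.Ico ((k : ℝ) / 2) ((k + 1) / 2) with hW
  have hq : ∀ i, ∃ q : ℚ, q ≠ 0 ∧ 0 < (q : ℝ) * B i ∧ (q : ℝ) * B i < 1 / 2 := fun i => by
    have hb : 0 < |B i| := abs_pos.2 (B.ne_zero i)
    obtain ⟨q, hq0, hq⟩ := exists_rat_btwn (show (0 : ℝ) < 1 / 2 / |B i| by positivity)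
    rw [lt_div_iff₀ hb] at hq
    have hqb : 0 < (q : ℝ) * |B i| := mul_pos hq0 hb
    have hq' : q ≠ 0 := by rintro rfl; simp at hq0
    rcases abs_choice (B i) with h | h <;> rw [h] at hq hqb
    · exact ⟨q, hq', hqb, hq⟩
    · exact ⟨-q, neg_ne_zero.2 hq', by push_cast; linarith, by push_cast; linarith⟩
  choose q hq0 hqpos hqlt using hq
  have hrepr : ∀ i j, B.repr ((q i : ℝ) * B i) j = if i = j then q i else 0 := fun i j => by
    rw [← Rat.smul_def, map_smul, B.repr_self, Finsupp.smul_single, smul_eq_mul, mul_one,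
      Finsupp.single_apply]
  set J := {i : ι // (e i).2 = n}
  set s : J → ℝ := fun j => (q j : ℝ) * B j with hs
  have hVn : ∀ x ∈ V n, ∀ j : J, B.repr x j = 0 := fun x hx j => by
    by_contra h
    exact (hx j h).ne j.2
  have hsep : ∀ x ∈ V n, ∀ y ∈ V n, ∀ i j : J, x + s i = y + s j → i = j := by
    intro x hx y hy i j h
    have h1 := congrArg (fun z => B.repr z i) h
    simp only [map_add, Finsupp.add_apply, hVn x hx i, hVn y hy i, hs, hrepr, if_true,
      zero_add] at h1
    by_contra hij
    rw [if_neg fun h => hij (Subtype.ext h.symm)] at h1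
    exact hq0 _ h1
  set S : J → Set ℝ := fun j => (fun t => t + (k / 2 - s j)) ⁻¹' W with hS
  refine ⟨J, fun j => Subtype.val ⁻¹' S j, s, volume W, ?_, pos_iff_ne_zero.2 hk, ?_, ?_, ?_⟩
  · refine Function.Injective.uncountable (α := ι) (f := fun i => ⟨e.symm (i, n), by simp⟩) ?_
    intro i i' h
    simpa using congrArg Subtype.val h
  · intro i j h
    exact hsep 0 (fun i hi => by simp at hi) 0 (fun i hi => by simp at hi) i j (by simpa using h)
  · intro i j hij
    refine Set.disjoint_left.2 fun t ht ht' => hij ?_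
    exact hsep _ ht.1 _ ht'.1 i j (by ring)
  · intro j
    have hsub : S j ⊆ Set.range (Subtype.val : unitInterval → ℝ) := fun t ht => by
      rw [Subtype.range_coe]
      have h1 := ht.2.1
      have h2 := ht.2.2
      have h3 := hqpos j
      have h4 := hqlt j
      simp only [hs] at h1 h2
      constructor <;> linarith
    have hemb : MeasurableEmbedding (Subtype.val : unitInterval → ℝ) :=
      MeasurableEmbedding.subtype_coe measurableSet_Icc
    have hvol : volume (Subtype.val ⁻¹' S j : Set unitInterval) = volume (S j) := by
      rw [Measure.Subtype.volume_def, hemb.comap_apply, Set.image_preimage_eq_of_subset hsub]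
    rw [hvol, hS, measure_preimage_add_right]

open Classical in
/-- The label `s j` of the set `S j` that contains `t`, and `0` if there is none. -/
noncomputable def label {J : Type} (S : J → Set unitInterval) (s : J → ℝ) (t : unitInterval) : ℝ :=
  if h : ∃ j, t ∈ S j then s h.choose else 0

lemma label_eq {J : Type} {S : J → Set unitInterval} {s : J → ℝ}
    (hS : ∀ i j, i ≠ j → Disjoint (S i) (S j)) {j : J} {t : unitInterval} (ht : t ∈ S j) :
    label S s t = s j := by
  have h : ∃ j, t ∈ S j := ⟨j, ht⟩
  rw [label, dif_pos h]
  congr 1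
  by_contra hne
  exact Set.disjoint_left.1 (hS _ _ hne) h.choose_spec ht

/-- The size bound attached to a pair of points: large when their labels are close. It vanishes
when the labels agree, since `0⁻¹ = 0`. -/
noncomputable def proximity (κ : unitInterval → ℝ) (t t' : unitInterval) : ℕ :=
  ⌊|κ t - κ t'|⁻¹⌋₊

/-- For every countable family of sets `U n` with a choice of some `U (m t) ∋ t`, finitely many of
the sets have measure more than `β` together, and are chosen at the points of an admissible set,
one point for each. Each `S j` gives finitely many indices `P`; as the `S j` are uncountably many,
infinitely many of them give the same `P`, with labels that differ by less than `1 / |P|`. The tags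
are taken in different ones of these. A second system of tags `τ'` avoids the first. -/
theorem exists_admissible_tags {J : Type} {S : J → Set unitInterval} {s : J → ℝ} {α β : ℝ≥0∞}
    [Uncountable J] (hβ : β < α) (hs : Function.Injective s)
    (hS : ∀ i j, i ≠ j → Disjoint (S i) (S j)) (hα : ∀ j, α ≤ volume (S j))
    {U : ℕ → Set unitInterval} {m : unitInterval → ℕ} (hm : ∀ t, t ∈ U (m t)) :
    ∃ (P : Finset ℕ) (τ τ' : ℕ → unitInterval), β < volume (⋃ n ∈ P, U n) ∧
      (∀ n ∈ P, m (τ n) = n ∧ m (τ' n) = n) ∧ Set.InjOn τ P ∧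
      (∀ n ∈ P, ∀ l ∈ P, τ' n ≠ τ l) ∧
      ∀ A : Finset unitInterval, (∀ t ∈ A, ∃ n ∈ P, τ n = t) →
        Admissible (proximity (label S s)) A := by
  classical
  have hfin : ∀ j, ∃ P : Finset ℕ, (∀ n ∈ P, ∃ t ∈ S j, m t = n) ∧
      β < volume (⋃ n ∈ P, U n) := fun j => by
    set Q : ℕ → Finset ℕ := fun N => (Finset.range N).filter (· ∈ m '' S j) with hQ
    have hmono : Monotone fun N => ⋃ n ∈ Q N, U n := fun N N' h =>
      Set.biUnion_subset_biUnion_left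
        (Finset.filter_subset_filter _ (Finset.range_subset_range.2 h))
    have hcov : S j ⊆ ⋃ N, ⋃ n ∈ Q N, U n := fun t ht => by
      simp only [Set.mem_iUnion]
      exact ⟨m t + 1, m t, by simp [hQ]; exact ⟨t.1, t.2, ht, rfl⟩, hm t⟩
    have hlt : β < ⨆ N, volume (⋃ n ∈ Q N, U n) := by
      rw [← hmono.measure_iUnion]
      exact hβ.trans_le ((hα j).trans (measure_mono hcov))
    obtain ⟨N, hN⟩ := lt_iSup_iff.1 hlt
    exact ⟨Q N, fun n hn => by simpa [hQ] using (Finset.mem_filter.1 hn).2, hN⟩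
  choose P hPm hPβ using hfin
  obtain ⟨⟨P₀, z⟩, hinf⟩ : ∃ p : Finset ℕ × ℤ,
      {j | (P j, ⌊((P j).card : ℝ) * s j⌋) = p}.Infinite := by
    by_contra! h
    have : (Set.univ : Set J).Countable := by
      refine (Set.countable_iUnion fun p => (h p).countable).mono ?_
      intro j _
      exact Set.mem_iUnion.2 ⟨_, rfl⟩
    exact not_countable (Set.countable_univ_iff.1 this)
  set I := {j | (P j, ⌊((P j).card : ℝ) * s j⌋) = (P₀, z)} with hI
  set f := hinf.natEmbedding I with hf
  have hP : ∀ a, P (f a) = P₀ := fun a => congrArg Prod.fst (f a).2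
  have hz : ∀ a, ⌊(P₀.card : ℝ) * s (f a)⌋ = z := fun a => by
    have := congrArg Prod.snd (f a).2
    simpa only [hP a] using this
  have htag : ∀ a n, ∃ t, n ∈ P₀ → t ∈ S (f a) ∧ m t = n := fun a n => by
    by_cases hn : n ∈ P₀
    · obtain ⟨t, h⟩ := hPm (f a) n (by rwa [hP a])
      exact ⟨t, fun _ => h⟩
    · exact ⟨0, fun h => absurd h hn⟩
  choose T hT using htag
  have hTne : ∀ a b n l, n ∈ P₀ → l ∈ P₀ → a ≠ b → T a n ≠ T b l := by
    intro a b n l hn hl hab h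
    have hne : (f a : J) ≠ f b := fun h => hab (f.injective (Subtype.ext h))
    have h1 := (hT a n hn).1
    rw [h] at h1
    exact Set.disjoint_left.1 (hS _ _ hne) h1 (hT b l hl).1
  refine ⟨P₀, fun n => T (2 * n) n, fun n => T (2 * n + 1) n, ?_, ?_, ?_, ?_, ?_⟩
  · simpa only [hP] using hPβ (f 0)
  · exact fun n hn => ⟨(hT _ n hn).2, (hT _ n hn).2⟩
  · intro n hn l hl h
    by_contra hne
    exact hTne (2 * n) (2 * l) n l hn hl (by omega) h
  · intro n hn l hl
    exact hTne (2 * n + 1) (2 * l) n l hn hl (by omega)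
  · intro A hA x hx y hy hxy
    obtain ⟨n, hn, rfl⟩ := hA x hx
    obtain ⟨l, hl, rfl⟩ := hA y hy
    have hcard : A.card ≤ P₀.card := by
      refine (Finset.card_le_card (t := P₀.image fun n => T (2 * n) n) fun t ht => ?_).trans
        Finset.card_image_le
      obtain ⟨n, hn, rfl⟩ := hA t ht
      exact Finset.mem_image_of_mem _ hn
    refine hcard.trans (Nat.le_floor ?_)
    rw [label_eq hS (hT (2 * n) n hn).1, label_eq hS (hT (2 * l) l hl).1]
    have hnl : n ≠ l := fun h => hxy (by rw [h])
    have hsne : s (f (2 * n)) - s (f (2 * l)) ≠ 0 := sub_ne_zero.2 fun h =>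
      hnl (by have := f.injective (Subtype.ext (hs h)); omega)
    have hclose := Int.abs_sub_lt_one_of_floor_eq_floor ((hz (2 * n)).trans (hz (2 * l)).symm)
    rw [← mul_sub, abs_mul, abs_of_nonneg (Nat.cast_nonneg _)] at hclose
    rw [← one_div, le_div_iff₀ (abs_pos.2 hsne)]
    exact hclose.le

end Partition

/-! ### Failure of McShane integrability -/

/-- For every gauge there are two Riemann sums with the same sets, whose tags differ only on a finite
family of total measure more than `β`, where `0 < β < α`. The tags of this family in the first sum
are distinct, form an admissible set, and do not occur among those that replace them in the second;
the remaining terms cancel, so the two sums have distance at least `β`. -/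
theorem not_mcShaneIntegrable_single {J : Type} {S : J → Set unitInterval} {s : J → ℝ} {α : ℝ≥0∞}
    [Uncountable J] (hα0 : 0 < α) (hs : Function.Injective s)
    (hS : ∀ i j, i ≠ j → Disjoint (S i) (S j)) (hα : ∀ j, α ≤ volume (S j)) :
    ¬ McShaneIntegrable (volume : Measure unitInterval)
      (fun t => (InterpSpace.single t : InterpSpace (proximity (label S s)))) := by
  classical
  rintro ⟨y, hy⟩
  obtain ⟨β, hβ0, hβα⟩ := exists_between hα0
  have hβtop : β ≠ ∞ := hβα.ne_top
  have hβr : 0 < β.toReal := ENNReal.toReal_pos hβ0.ne' hβtop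
  obtain ⟨η, hη, δ, hδ, H⟩ := hy (β.toReal / 4) (by positivity)
  obtain ⟨U, hU⟩ : ∃ U : ℕ → Set unitInterval,
      TopologicalSpace.IsTopologicalBasis (Set.range U) := by
    have hb := TopologicalSpace.isBasis_countableBasis unitInterval
    obtain ⟨O, hO, -⟩ := hb.exists_subset_of_mem_open (Set.mem_univ 0) isOpen_univ
    obtain ⟨U, hU⟩ := (TopologicalSpace.countable_countableBasis unitInterval).exists_eq_range
      ⟨O, hO⟩
    exact ⟨U, hU ▸ hb⟩
  have hUopen : ∀ n, IsOpen (U n) := fun n => hU.isOpen ⟨n, rfl⟩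
  have hm : ∀ t, ∃ n, t ∈ U n ∧ U n ⊆ δ t := fun t => by
    obtain ⟨_, ⟨n, rfl⟩, h1, h2⟩ := hU.exists_subset_of_mem_open (hδ t).2 (hδ t).1
    exact ⟨n, h1, h2⟩
  choose m hmem hsub using hm
  obtain ⟨P, τ, τ', hP, hτ, hinj, hne, hadm⟩ := exists_admissible_tags hβα hs hS hα hmem
  -- the sets of the Riemann sums: those with index in `P` come first
  set UP := ⋃ n ∈ P, U n with hUP
  set W : ℕ → Set unitInterval := fun n =>
    if n ∈ P then U n else if n ∈ Set.range m then U n \ UP else ∅ with hW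
  have hWU : ∀ n, W n ⊆ U n := fun n => by
    simp only [hW]
    split_ifs
    · exact subset_rfl
    · exact Set.sdiff_subset
    · exact Set.empty_subset _
  have hWP : ∀ n ∉ P, Disjoint (W n) UP := fun n hn => by
    simp only [hW, if_neg hn]
    split_ifs
    · exact Set.disjoint_sdiff_left
    · exact Set.empty_disjoint _
  have hWm : ∀ n, MeasurableSet (W n) := fun n => by
    have : MeasurableSet UP :=
      (isOpen_biUnion fun n _ => hUopen n).measurableSet
    simp only [hW]
    split_ifs
    · exact (hUopen n).measurableSet
    · exact (hUopen n).measurableSet.diff this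
    · exact MeasurableSet.empty
  have hWcov : (⋃ n, W n) = Set.univ := by
    refine Set.eq_univ_of_forall fun t => Set.mem_iUnion.2 ?_
    by_cases ht : t ∈ UP
    · obtain ⟨n, hn, h⟩ := Set.mem_iUnion₂.1 ht
      exact ⟨n, by simpa only [hW, if_pos hn] using h⟩
    · have hn : m t ∉ P := fun h => ht (Set.mem_iUnion₂.2 ⟨_, h, hmem t⟩)
      refine ⟨m t, ?_⟩
      simp only [hW, if_neg hn, if_pos (Set.mem_range_self t)]
      exact ⟨hmem t, ht⟩
  set E := disjointed W with hE
  have hEm : ∀ n, MeasurableSet (E n) := fun n => MeasurableSet.disjointed hWm n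
  have hEW : ∀ n, E n ⊆ W n := disjointed_subset W
  have hEdisj : Pairwise (Function.onFun Disjoint E) := disjoint_disjointed W
  have hEcov : (⋃ n, E n) = Set.univ := by rw [hE, iUnion_disjointed, hWcov]
  have hEP : UP ⊆ ⋃ n ∈ P, E n := fun t ht => by
    obtain ⟨n, hn⟩ := Set.mem_iUnion.1 (hEcov.symm ▸ Set.mem_univ t : t ∈ ⋃ n, E n)
    refine Set.mem_iUnion₂.2 ⟨n, ?_, hn⟩
    by_contra hnP
    exact Set.disjoint_left.1 (hWP n hnP) (hEW n hn) ht
  obtain ⟨N, hNη, hPN⟩ : ∃ N, volume (⋃ i : Fin N, E i)ᶜ ≤ ENNReal.ofReal η ∧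
      P ⊆ Finset.range N := by
    have hanti : Antitone fun N : ℕ => (⋃ i : Fin N, E i)ᶜ := fun N N' h =>
      Set.compl_subset_compl.2 <| Set.iUnion_subset fun i =>
        Set.subset_iUnion (fun i : Fin N' => E i) (Fin.castLE h i)
    have hlim := tendsto_measure_iInter_atTop (μ := (volume : Measure unitInterval))
      (s := fun N : ℕ => (⋃ i : Fin N, E i)ᶜ)
      (fun N => (MeasurableSet.iUnion fun i : Fin N => hEm i).compl.nullMeasurableSet) hanti
      ⟨0, measure_ne_top _ _⟩
    have hempty : (⋂ N : ℕ, (⋃ i : Fin N, E i)ᶜ) = ∅ := by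
      refine Set.eq_empty_of_forall_notMem fun t ht => ?_
      obtain ⟨n, hn⟩ := Set.mem_iUnion.1 (hEcov.symm ▸ Set.mem_univ t : t ∈ ⋃ n, E n)
      exact Set.mem_iInter.1 ht (n + 1) (Set.mem_iUnion.2 ⟨⟨n, n.lt_succ_self⟩, hn⟩)
    rw [hempty, measure_empty] at hlim
    have h1 := hlim.eventually_le_const (ENNReal.ofReal_pos.2 hη)
    obtain ⟨N, hN1, hN2⟩ := (h1.and (Filter.eventually_ge_atTop (P.sup id + 1))).exists
    refine ⟨N, hN1, fun n hn => Finset.mem_range.2 ?_⟩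
    have := Finset.le_sup (f := id) hn
    simp only [id] at this
    omega
  have hδE : ∀ (σ : ℕ → unitInterval), (∀ n ∈ P, m (σ n) = n) → ∀ n,
      E n ⊆ δ (if n ∈ P then σ n else Function.invFun m n) := by
    intro σ hσ n t ht
    have htU := hWU n (hEW n ht)
    split_ifs with hn
    · exact hsub _ (by rwa [hσ n hn])
    · have hr : n ∈ Set.range m := by
        by_contra hr
        have := hEW n ht
        simp only [hW, if_neg hn, if_neg hr] at this
        exact this
      exact hsub _ (by rwa [Function.invFun_eq hr])
  have hsum : ∀ (σ : ℕ → unitInterval), (∀ n ∈ P, m (σ n) = n) →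
      ‖(∑ n ∈ Finset.range N, volume.real (E n) • (InterpSpace.single
        (if n ∈ P then σ n else Function.invFun m n) : InterpSpace (proximity (label S s)))) - y‖
        ≤ β.toReal / 4 := by
    intro σ hσ
    rw [← Fin.sum_univ_eq_sum_range (fun n => volume.real (E n) • (InterpSpace.single
        (if n ∈ P then σ n else Function.invFun m n) : InterpSpace (proximity (label S s))))]
    exact H N (fun i => E i) (fun i => if (i : ℕ) ∈ P then σ i else Function.invFun m i)
      (fun i => (hEm i).nullMeasurableSet)
      (fun i j hij => hEdisj (fun h => hij (Fin.ext h))) hNη (fun i => hδE σ hσ i)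
  have h1 := hsum τ fun n hn => (hτ n hn).1
  have h2 := hsum τ' fun n hn => (hτ n hn).2
  set w₁ := ∑ n ∈ Finset.range N, volume.real (E n) • (InterpSpace.single
        (if n ∈ P then τ n else Function.invFun m n) : InterpSpace (proximity (label S s)))
  set w₂ := ∑ n ∈ Finset.range N, volume.real (E n) • (InterpSpace.single
        (if n ∈ P then τ' n else Function.invFun m n) : InterpSpace (proximity (label S s)))
  have hw : ‖w₁ - w₂‖ ≤ β.toReal / 2 := by
    have := norm_sub_le (w₁ - y) (w₂ - y)
    rw [sub_sub_sub_cancel_right] at this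
    linarith
  have hval : ∀ l ∈ P, (w₁ - w₂) (τ l) = volume.real (E l) := by
    intro l hl
    have : ∀ n, volume.real (E n) * (InterpSpace.single
        (if n ∈ P then τ n else Function.invFun m n) : InterpSpace (proximity (label S s))) (τ l)
        - volume.real (E n) * (InterpSpace.single
        (if n ∈ P then τ' n else Function.invFun m n) : InterpSpace (proximity (label S s))) (τ l)
        = if n = l then volume.real (E n) else 0 := by
      intro n
      by_cases hn : n ∈ P
      · rw [if_pos hn, if_pos hn, InterpSpace.single_apply, InterpSpace.single_apply,
          if_neg (hne n hn l hl).symm]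
        by_cases hnl : n = l
        · simp [hnl]
        · rw [if_neg fun h => hnl (hinj hn hl h.symm), if_neg hnl]; simp
      · have hnl : n ≠ l := fun h => hn (h ▸ hl)
        simp [hn, hnl]
    rw [InterpSpace.sub_apply, InterpSpace.sum_apply, InterpSpace.sum_apply,
      ← Finset.sum_sub_distrib]
    simp only [InterpSpace.smul_apply, this, Finset.sum_ite_eq', if_pos (hPN hl)]
  have hA := hadm (P.image τ) fun t ht => by simpa using ht
  have hlow : β.toReal ≤ ‖w₁ - w₂‖ := by
    calc β.toReal ≤ volume.real UP := ENNReal.toReal_mono (measure_ne_top _ _) hP.le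
      _ ≤ volume.real (⋃ n ∈ P, E n) := measureReal_mono hEP (measure_ne_top _ _)
      _ ≤ ∑ n ∈ P, volume.real (E n) := measureReal_biUnion_finset_le _ _
      _ = ∑ n ∈ P, |(w₁ - w₂) (τ n)| := Finset.sum_congr rfl fun n hn => by
          rw [hval n hn, abs_of_nonneg measureReal_nonneg]
      _ = ∑ t ∈ P.image τ, |(w₁ - w₂) t| :=
          (Finset.sum_image (f := fun t => |(w₁ - w₂) t|) hinj).symm
      _ ≤ InterpSpace.level 0 (w₁ - w₂) := by
          simpa using InterpSpace.sum_abs_le_level (n := 0) (hA.coveredBy le_rfl) (w₁ - w₂)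
      _ ≤ ‖w₁ - w₂‖ := InterpSpace.level_le_norm 0 _
  linarith

theorem theorem3p6 :
    ∃ (Y : Type) (_ : NormedAddCommGroup Y) (_ : NormedSpace ℝ Y) (_ : CompleteSpace Y)
      (g : unitInterval → Y),
      IsReflexiveSpace Y ∧
      ScalarlyNull (volume : Measure unitInterval) g ∧
      ¬ McShaneIntegrable (volume : Measure unitInterval) g := by
  obtain ⟨J, S, s, α, hJ, hα0, hs, hS, hα⟩ := exists_pairwise_disjoint_volume_ge
  refine ⟨InterpSpace (proximity (label S s)), inferInstance, inferInstance, inferInstance,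
    fun t => InterpSpace.single t, InterpSpace.isReflexiveSpace, fun φ => ?_,
    not_mcShaneIntegrable_single hα0 hs hS hα⟩
  exact (InterpSpace.countable_apply_single_ne_zero φ).measure_zero volume
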